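/- Let $\theta$ be an irrational real number and let $\gamma\in C(S^1)$ be a non-negative function. Let $A_{\theta,\gamma}$ be the universal unital $C^*$-algebra generated by two elements $x,w$ subject to the relations $$w^*w=ww^*=1,\qquad x^*x=\gamma(w),\qquad xx^*=\gamma(e^{-2\pi i\theta}w),\qquad xw=e^{-2\pi i\theta}wx .$$ Call a function $g$ on $S^1$ periodic if there is $\zeta\in S^1$, $\zeta\neq 1$, with $g(\zeta z)=g(z)$ for all $z\in S^1$. Suppose that $A_{\theta,\gamma}$ is simple. Then there is a function $f\in C(S^1)$ such that for every nonzero unital $C^*$-algebra $B$ and all unitaries $u,v\in B$ with $vu=e^{2\pi i\theta}uv$, there is an injective unital $*$-homomorphism $\Phi\colon A_{\theta,\gamma}\to B$ with $\Phi(x)=u\gamma^{1/2}(v)$, $\Phi(w)=v$, and $$\Phi(A_{\theta,\gamma})=C^*(u\gamma^{1/2}(v),v)=C^*(uf(v),1).$$ That is, under the identification $A_{\theta,\gamma}=C^*(u\gamma^{1/2}(v),v)$, the algebra $A_{\theta,\gamma}$ is generated by the single element $uf(v)$ together with the identity. Moreover, $f$ can be chosen so that $f=\gamma^{1/2}$ if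 $\gamma$ is not periodic, while if $\gamma$ is periodic, then $f(z)=(\gamma(z)|2+z|)^{1/2}$ for all $z$ or $f(z)=(\gamma(z)|3+z|)^{1/2}$ for all $z$. -/

import Mathlib

universe u

open scoped ENNReal

noncomputable section

namespace RotationAlgebra

/-- For a unitary element `w` of a unital C*-algebra and a continuous function `f` on the unit
circle, the element `f(w)` given by the continuous functional calculus. (The functional calculus
of Mathlib takes functions on `ℂ`; `f` is extended by `0`, and only its values on the spectrum
of `w`, a subset of the circle, matter.) -/
def circleCalculus {A : Type*} [CStarAlgebra A] (f : Circle → ℂ) (w : A) : A :=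
  cfc (Function.extend (fun z : Circle => (z : ℂ)) f 0) w

/-- The defining relations of the generalized universal irrational rotation algebra:
`w*w = ww* = 1`, `x*x = γ(w)`, `xx* = γ(e^{-2πiθ}w)`, `xw = e^{-2πiθ}wx`. -/
structure Relations {A : Type*} [CStarAlgebra A] (θ : ℝ) (γ : C(Circle, ℝ)) (x w : A) : Prop where
  star_mul_w : star w * w = 1
  w_mul_star : w * star w = 1
  star_mul_x : star x * x = circleCalculus (fun z => (γ z : ℂ)) w
  x_mul_star : x * star x = circleCalculus (fun z => (γ z : ℂ))
    (Complex.exp (-(2 * Real.pi * Complex.I * θ)) • w)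
  x_mul_w : x * w = Complex.exp (-(2 * Real.pi * Complex.I * θ)) • (w * x)

/-- A representation of the relations in some nonzero unital C*-algebra. -/
structure Rep (θ : ℝ) (γ : C(Circle, ℝ)) : Type (u + 1) where
  carrier : Type u
  [cstar : CStarAlgebra carrier]
  [nontriv : Nontrivial carrier]
  x : carrier
  w : carrier
  rel : Relations θ γ x w

attribute [instance] Rep.cstar Rep.nontriv

theorem exists_circle_coe_eq {z : ℂ} (hz : z ∈ Metric.sphere (0 : ℂ) 1) :
    ∃ ζ : Circle, (ζ : ℂ) = z :=
  ⟨⟨z, hz⟩, rfl⟩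

theorem extend_coe (f : Circle → ℂ) (ζ : Circle) :
    Function.extend (fun z : Circle => (z : ℂ)) f 0 (ζ : ℂ) = f ζ :=
  Function.Injective.extend_apply Circle.coe_injective f 0 ζ

theorem continuousOn_extend {f : Circle → ℂ} (hf : Continuous f) {s : Set ℂ}
    (hs : s ⊆ Metric.sphere 0 1) :
    ContinuousOn (Function.extend (fun z : Circle => (z : ℂ)) f 0) s := by
  intro z hz
  obtain ⟨ζ, rfl⟩ := exists_circle_coe_eq (hs hz)
  refine ContinuousWithinAt.mono (t := Set.range fun z : Circle => (z : ℂ)) ?_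
    fun y hy => exists_circle_coe_eq (hs hy)
  have he : Topology.IsInducing fun z : Circle => (z : ℂ) := Topology.IsInducing.subtypeVal
  rw [ContinuousWithinAt, extend_coe, ← he.map_nhds_eq, Filter.tendsto_map'_iff]
  exact (hf.tendsto ζ).congr fun y => (extend_coe f y).symm

theorem Relations.mem_unitary {A : Type*} [CStarAlgebra A] {θ : ℝ} {γ : C(Circle, ℝ)} {x w : A}
    (h : Relations θ γ x w) : w ∈ unitary A :=
  Unitary.mem_iff.2 ⟨h.star_mul_w, h.w_mul_star⟩

theorem norm_circleCalculus_le {A : Type*} [CStarAlgebra A] (γ : C(Circle, ℝ)) {w : A}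
    (hw : w ∈ unitary A) : ‖circleCalculus (fun z => (γ z : ℂ)) w‖ ≤ ‖γ‖ := by
  refine norm_cfc_le (norm_nonneg γ) fun z hz => ?_
  obtain ⟨ζ, rfl⟩ := exists_circle_coe_eq (spectrum.subset_circle_of_unitary hw hz)
  rw [extend_coe, Complex.norm_real]
  exact γ.norm_coe_le_norm _

/-- The C*-algebra of all bounded families indexed by the representations of the relations. -/
abbrev Ambient (θ : ℝ) (γ : C(Circle, ℝ)) : Type (u + 1) :=
  lp (fun i : Rep.{u} θ γ => i.carrier) ∞

instance ambientCStar (θ : ℝ) (γ : C(Circle, ℝ)) : CStarAlgebra (Ambient θ γ) where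

/-- The universal `x`: its component at a representation `i` is the `x` of `i`. -/
def ambientX (θ : ℝ) (γ : C(Circle, ℝ)) : Ambient θ γ :=
  ⟨fun i => i.x, by
    refine memℓp_infty ⟨Real.sqrt ‖γ‖, ?_⟩
    rintro _ ⟨i, rfl⟩
    refine Real.le_sqrt_of_sq_le ?_
    have h := norm_circleCalculus_le γ i.rel.mem_unitary
    rw [← i.rel.star_mul_x, CStarRing.norm_star_mul_self] at h
    simpa [sq] using h⟩

/-- The universal `w`: its component at a representation `i` is the `w` of `i`. -/
def ambientW (θ : ℝ) (γ : C(Circle, ℝ)) : Ambient θ γ :=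
  ⟨fun i => i.w, by
    refine memℓp_infty ⟨1, ?_⟩
    rintro _ ⟨i, rfl⟩
    exact (CStarRing.norm_of_mem_unitary i.rel.mem_unitary).le⟩

/-- The C*-subalgebra `C*(S, 1)` generated by a set `S` and the identity. -/
def cstarGen {A : Type*} [CStarAlgebra A] (S : Set A) : StarSubalgebra ℂ A :=
  (StarAlgebra.adjoin ℂ S).topologicalClosure

/-- The generalized universal irrational rotation algebra `A_{θ,γ}`: the universal unital
C*-algebra generated by `x` and `w` subject to the relations above, realized as the C*-algebra
generated by the universal pair inside the product of all representations. -/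
def GenRotAlgebra (θ : ℝ) (γ : C(Circle, ℝ)) : Type (u + 1) :=
  cstarGen ({ambientX.{u} θ γ, ambientW.{u} θ γ} : Set (Ambient.{u} θ γ))

instance (θ : ℝ) (γ : C(Circle, ℝ)) : CStarAlgebra (GenRotAlgebra θ γ) :=
  StarSubalgebra.cstarAlgebra _ (h_closed := StarSubalgebra.isClosed_topologicalClosure _)

/-- The generator `x` of `A_{θ,γ}`. -/
def genX (θ : ℝ) (γ : C(Circle, ℝ)) : GenRotAlgebra θ γ :=
  ⟨ambientX θ γ, StarSubalgebra.le_topologicalClosure _ (StarAlgebra.subset_adjoin ℂ _ (by simp))⟩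

/-- The generator `w` of `A_{θ,γ}`. -/
def genW (θ : ℝ) (γ : C(Circle, ℝ)) : GenRotAlgebra θ γ :=
  ⟨ambientW θ γ, StarSubalgebra.le_topologicalClosure _ (StarAlgebra.subset_adjoin ℂ _ (by simp))⟩

/-- The canonical map from `A_{θ,γ}` to the algebra carrying a representation. -/
def GenRotAlgebra.toRep {θ : ℝ} {γ : C(Circle, ℝ)} (i : Rep θ γ) :
    GenRotAlgebra θ γ →⋆ₐ[ℂ] i.carrier where
  toFun a := (a.1 : Ambient θ γ) i
  map_one' := rfl
  map_mul' _ _ := rfl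
  map_zero' := rfl
  map_add' _ _ := rfl
  commutes' _ := rfl
  map_star' _ := rfl

theorem continuous_starAlgHom {A B : Type*} [CStarAlgebra A] [CStarAlgebra B]
    (Φ : A →⋆ₐ[ℂ] B) : Continuous Φ :=
  AddMonoidHomClass.continuous_of_bound Φ 1 fun a => by
    simpa using NonUnitalStarAlgHom.norm_apply_le Φ a

theorem map_circleCalculus {A B : Type*} [CStarAlgebra A] [CStarAlgebra B] (Φ : A →⋆ₐ[ℂ] B)
    {f : Circle → ℂ} (hf : Continuous f) {w : A} (hw : w ∈ unitary A) :
    Φ (circleCalculus f w) = circleCalculus f (Φ w) := by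
  have : IsStarNormal w := ⟨by
    rw [commute_iff_eq, (Unitary.mem_iff.1 hw).1, (Unitary.mem_iff.1 hw).2]⟩
  exact StarAlgHomClass.map_cfc Φ _ w
    (continuousOn_extend hf (spectrum.subset_circle_of_unitary hw)) (continuous_starAlgHom Φ) this
    (this.map Φ)

theorem norm_phase (θ : ℝ) : ‖Complex.exp (-(2 * Real.pi * Complex.I * θ))‖ = 1 := by
  rw [Complex.norm_exp]; simp

theorem smul_mem_unitary {A : Type*} [CStarAlgebra A] {c : ℂ} (hc : ‖c‖ = 1) {w : A}
    (hw : w ∈ unitary A) : c • w ∈ unitary A := by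
  have h1 : star c * c = 1 := by
    rw [Complex.star_def, Complex.conj_mul', hc]; simp
  rw [Unitary.mem_iff] at *
  simp only [star_smul, smul_mul_smul_comm, hw.1, hw.2, h1, mul_comm c, one_smul, and_self]

/-- The generators of `A_{θ,γ}` satisfy the defining relations. -/
theorem genRelations (θ : ℝ) (γ : C(Circle, ℝ)) :
    Relations θ γ (genX θ γ) (genW θ γ) := by
  have ext : ∀ a b : GenRotAlgebra θ γ,
      (∀ i, GenRotAlgebra.toRep i a = GenRotAlgebra.toRep i b) → a = b :=
    fun a b h => Subtype.ext (lp.ext (funext h))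
  have hX : ∀ i, GenRotAlgebra.toRep i (genX θ γ) = i.x := fun _ => rfl
  have hW : ∀ i, GenRotAlgebra.toRep i (genW θ γ) = i.w := fun _ => rfl
  have h1 : star (genW θ γ) * genW θ γ = 1 := ext _ _ fun i => by
    rw [map_mul, map_star, map_one, hW, i.rel.star_mul_w]
  have h2 : genW θ γ * star (genW θ γ) = 1 := ext _ _ fun i => by
    rw [map_mul, map_star, map_one, hW, i.rel.w_mul_star]
  have hw : genW θ γ ∈ unitary (GenRotAlgebra θ γ) := Unitary.mem_iff.2 ⟨h1, h2⟩
  have hγ : Continuous fun z : Circle => (γ z : ℂ) := by fun_prop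
  refine ⟨h1, h2, ext _ _ fun i => ?_, ext _ _ fun i => ?_, ext _ _ fun i => ?_⟩
  · rw [map_mul, map_star, hX, map_circleCalculus _ hγ hw, hW, i.rel.star_mul_x]
  · rw [map_mul, map_star, hX, map_circleCalculus _ hγ (smul_mem_unitary (norm_phase θ) hw),
      map_smul, hW, i.rel.x_mul_star]
  · rw [map_mul, map_smul, map_mul, hX, hW, i.rel.x_mul_w]

/-- The universal property of `A_{θ,γ}`. -/
theorem GenRotAlgebra.existsUnique_hom (θ : ℝ) (γ : C(Circle, ℝ)) {B : Type u}
    [CStarAlgebra B] [Nontrivial B] {x w : B} (h : Relations θ γ x w) :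
    ∃! Φ : GenRotAlgebra.{u} θ γ →⋆ₐ[ℂ] B, Φ (genX θ γ) = x ∧ Φ (genW θ γ) = w := by
  refine ⟨GenRotAlgebra.toRep ⟨B, x, w, h⟩, ⟨rfl, rfl⟩, fun Ψ hΨ => ?_⟩
  have hc : Continuous Ψ := continuous_starAlgHom Ψ
  have hd : Continuous (GenRotAlgebra.toRep (⟨B, x, w, h⟩ : Rep θ γ)) := continuous_starAlgHom _
  refine StarAlgHom.ext_topologicalClosure (S := StarAlgebra.adjoin ℂ
    ({ambientX θ γ, ambientW θ γ} : Set (Ambient θ γ))) hc hd ?_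
  refine StarAlgHom.ext_adjoin ?_
  rintro ⟨y, hy⟩ (rfl | rfl)
  · exact hΨ.1
  · exact hΨ.2

/-- A C*-algebra is simple if it is nonzero and has no closed two-sided ideals other than
`0` and the whole algebra. -/
def IsSimpleCStarAlgebra (A : Type*) [CStarAlgebra A] : Prop :=
  Nontrivial A ∧ ∀ J : TwoSidedIdeal A, IsClosed (J : Set A) → J = ⊥ ∨ J = ⊤

/-- A function on the unit circle is periodic if it is invariant under some nontrivial rotation. -/
def IsCirclePeriodic (g : Circle → ℝ) : Prop :=
  ∃ ζ : Circle, ζ ≠ 1 ∧ ∀ z, g (ζ * z) = g z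

end RotationAlgebra
end

open RotationAlgebra

/-!
Put `c = e^{2πiθ}`. For unitaries `u, v` with `vu = c uv`, the pair `(u γ^{1/2}(v), v)` satisfies
the defining relations, so the universal property gives `Φ`. The kernel of `Φ` is a closed ideal,
hence trivial by simplicity; so `Φ` is isometric and its range is the C*-algebra generated by the
images of the generators. What remains is to show that `u f(v)` alone generates `v`.

* Simplicity forces `γ` to have at most one zero on each orbit of the rotation by `c`
  (`ne_zero_of_isSimpleCStarAlgebra`). Two zeros on one orbit give a finite-dimensional
  representation by a weighted shift (`exists_rep_aeval_eq_zero`). It is faithful, so `w` is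
  annihilated by a nonzero polynomial, and hence so is `v`. But the spectrum of `v` is invariant
  under the rotation by `c`, hence infinite (`aeval_ne_zero`).
* Let `g ≥ 0` be a non-periodic function with at most one zero on each orbit, and let
  `y = u g^{1/2}(v)`. Then `C*(y)` contains `y*ⁿyⁿ = (∏_{k < n} g(cᵏ ·))(v)` and
  `yⁿy*ⁿ = (∏_{k < n} g(c⁻ᵏ⁻¹ ·))(v)`. These products separate the points of the circle
  (`exists_prod_ne`): along the half-orbits without zeros they determine the values of `g`, and two
  points with the same values of `g` along dense half-orbits differ by a period of `g`. By the
  Stone–Weierstrass theorem, `C*(y)` contains all `h(v)` (`circleCalculus_mem_cstarGen`).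
* If `γ` is not periodic, this applies to `g = γ`. If it is, it applies to `g = γ · |2 + z|`, which
  is never periodic (`not_isCirclePeriodic_mul_norm`). In that case `u γ^{1/2}(v)` is recovered
  from `u g^{1/2}(v)` by multiplying by the inverse of `|2 + v|^{1/2}`. The alternative
  `|3 + z|` is never needed.
-/

namespace RotationAlgebra

/-! ### Irrational rotations of the circle -/

theorem denseRange_exp_pow {θ : ℝ} (hθ : Irrational θ) :
    DenseRange (fun n : ℕ => Circle.exp (2 * Real.pi * θ) ^ n) := by
  rw [← denseRange_zpow_iff_pow]
  have h1 : DenseRange (fun n : ℤ => n • ((θ : ℝ) : AddCircle (1 : ℝ))) :=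
    AddCircle.denseRange_zsmul_coe_iff.2 (by simpa using hθ)
  have h2 := (AddCircle.homeomorphCircle (one_ne_zero (α := ℝ))).surjective.denseRange.comp h1
    (AddCircle.homeomorphCircle (one_ne_zero (α := ℝ))).continuous
  convert h2 using 2 with n
  simp [AddCircle.homeomorphCircle_apply, AddCircle.toCircle_zsmul, AddCircle.toCircle_apply_mk]

theorem denseRange_inv_pow {c : Circle} (hc : DenseRange (fun n : ℕ => c ^ n)) :
    DenseRange (fun n : ℕ => c⁻¹ ^ n) := by
  have h := (Homeomorph.inv Circle).surjective.denseRange.comp hc (Homeomorph.inv Circle).continuous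
  simpa [Function.comp_def] using h

theorem forall_of_forall_pow_mul {c : Circle} (hc : DenseRange (fun n : ℕ => c ^ n))
    {p : Circle → Prop} (hp : IsClosed {z | p z}) (a : Circle) (h : ∀ n : ℕ, p (c ^ n * a))
    (z : Circle) : p z := by
  have hcl : IsClosed {y | p (y * a)} := hp.preimage (f := fun y => y * a) (by fun_prop)
  have := hc.induction_on (p := fun y => p (y * a)) (z * a⁻¹) hcl h
  simpa using this

/-- A continuous function that takes the same values along the orbits of two different points
under a rotation with dense orbits is periodic. -/
theorem isCirclePeriodic_of_eq_on_orbits {c : Circle} (hc : DenseRange (fun n : ℕ => c ^ n))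
    (g : C(Circle, ℝ)) {a b : Circle} (hab : a ≠ b)
    (h : ∀ n : ℕ, g (c ^ n * a) = g (c ^ n * b)) : IsCirclePeriodic g := by
  refine ⟨b * a⁻¹, fun H => hab (mul_inv_eq_one.1 H).symm, ?_⟩
  refine forall_of_forall_pow_mul hc (isClosed_eq (by fun_prop) (by fun_prop)) a fun n => ?_
  rw [h n]
  congr 1
  rw [mul_comm (b * a⁻¹), mul_assoc, mul_comm b, mul_inv_cancel_left]

theorem eq_of_forall_prod_eq {a b : ℕ → ℝ} (ha : ∀ k, a k ≠ 0)
    (h : ∀ n, ∏ k ∈ Finset.range n, a k = ∏ k ∈ Finset.range n, b k) (n : ℕ) : a n = b n := by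
  have h1 := h (n + 1)
  rw [Finset.prod_range_succ, Finset.prod_range_succ, ← h n] at h1
  exact mul_left_cancel₀ (Finset.prod_ne_zero_iff.2 fun k _ => ha k) h1

/-- Suppose that `g` is not periodic and has at most one zero on each orbit of the rotation by
`c`. Then the products of the values of `g` along the initial pieces of the forward and of the
backward orbit separate the points of the circle. A zero of `g` can spoil only one of the two
half-orbits of a point, and along the other one the products determine the values of `g`. -/
theorem exists_prod_ne {c : Circle} (hc : DenseRange (fun n : ℕ => c ^ n)) (g : C(Circle, ℝ))
    (hg : ¬ IsCirclePeriodic g) (h0 : ∀ (z : Circle) (m : ℕ), g z = 0 → g (c ^ (m + 1) * z) ≠ 0)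
    {a b : Circle} (hab : a ≠ b) : ∃ n : ℕ,
      ∏ k ∈ Finset.range n, g (c ^ k * a) ≠ ∏ k ∈ Finset.range n, g (c ^ k * b) ∨
      ∏ k ∈ Finset.range n, g (c⁻¹ ^ (k + 1) * a) ≠ ∏ k ∈ Finset.range n, g (c⁻¹ ^ (k + 1) * b) := by
  by_contra! H
  refine hg ?_
  by_cases hf : ∀ k : ℕ, g (c ^ k * a) ≠ 0
  · exact isCirclePeriodic_of_eq_on_orbits hc g hab
      (eq_of_forall_prod_eq hf fun n => (H n).1)
  · push Not at hf
    obtain ⟨k, hk⟩ := hf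
    have hb : ∀ j : ℕ, g (c⁻¹ ^ (j + 1) * a) ≠ 0 := fun j hj => by
      refine h0 _ (j + k) hj ?_
      rwa [← mul_assoc, show j + k + 1 = k + (j + 1) by omega, pow_add, mul_assoc (c ^ k),
        ← mul_pow, mul_inv_cancel, one_pow, mul_one]
    have h := eq_of_forall_prod_eq hb fun n => (H n).2
    refine isCirclePeriodic_of_eq_on_orbits (denseRange_inv_pow hc) g
      (a := c⁻¹ * a) (b := c⁻¹ * b) (by simpa using hab) fun n => ?_
    rw [← mul_assoc, ← mul_assoc, ← pow_succ]
    exact h n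

theorem normSq_two_add (z : Circle) : ‖(2 : ℂ) + z‖ ^ 2 = 5 + 4 * (z : ℂ).re := by
  have h := Circle.normSq_coe z
  rw [← Complex.normSq_eq_norm_sq]
  rw [Complex.normSq_apply] at *
  simp only [Complex.add_re, Complex.add_im, Complex.re_ofNat, Complex.im_ofNat]
  linarith

theorem two_add_ne_zero (z : Circle) : (2 : ℂ) + z ≠ 0 := fun h => by
  have h1 : ‖(z : ℂ)‖ = 1 := Circle.norm_coe z
  rw [eq_neg_of_add_eq_zero_right h] at h1
  norm_num at h1

/-- The function `z ↦ ‖2 + z‖` on the circle satisfies no multiplicative relation of the form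
`n(ηz) n(ζz) = n(ηζz) n(z)` with `η, ζ ≠ 1`: by `‖2 + z‖² = 5 + 4 Re z`, the odd part of the
square of the relation gives `η + ζ = ηζ + 1`. -/
theorem eq_one_or_eq_one_of_norm_two_add {η ζ : Circle}
    (h : ∀ z : Circle, ‖(2 : ℂ) + (η * z : Circle)‖ * ‖(2 : ℂ) + (ζ * z : Circle)‖ =
      ‖(2 : ℂ) + (η * ζ * z : Circle)‖ * ‖(2 : ℂ) + z‖) : η = 1 ∨ ζ = 1 := by
  have key : ∀ z : Circle, (((η : ℂ) + ζ - η * ζ - 1) * z).re = 0 := fun z => by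
    have h1 := congrArg (· ^ 2) (h z)
    have h2 := congrArg (· ^ 2) (h (-z))
    simp only [mul_pow, normSq_two_add] at h1 h2
    simp only [Circle.coe_mul, Circle.coe_neg, mul_neg, Complex.neg_re] at h1 h2
    simp only [sub_mul, add_mul, Complex.sub_re, Complex.add_re, one_mul]
    linarith
  have h1 := key 1
  have h2 := key (Circle.exp (Real.pi / 2))
  have h3 : ((η : ℂ) - 1) * (ζ - 1) = 0 := by
    rw [Circle.coe_exp] at h2
    push_cast at h2
    rw [Complex.exp_pi_div_two_mul_I, Complex.mul_I_re, neg_eq_zero] at h2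
    rw [Circle.coe_one, mul_one] at h1
    have : (η : ℂ) + ζ - η * ζ - 1 = 0 := Complex.ext h1 h2
    linear_combination -this
  rcases mul_eq_zero.1 h3 with h | h
  · exact Or.inl (Circle.ext (by simpa using sub_eq_zero.1 h))
  · exact Or.inr (Circle.ext (by simpa using sub_eq_zero.1 h))

/-- Multiplication by `‖2 + z‖` destroys periodicity. -/
theorem not_isCirclePeriodic_mul_norm {c : Circle} (hc : DenseRange (fun n : ℕ => c ^ n))
    (g : C(Circle, ℝ)) (hg : IsCirclePeriodic g)
    (h0 : ∀ (z : Circle) (m : ℕ), g z = 0 → g (c ^ (m + 1) * z) ≠ 0) :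
    ¬ IsCirclePeriodic fun z => g z * ‖(2 : ℂ) + z‖ := by
  rintro ⟨η, hη, h⟩
  obtain ⟨ζ, hζ, hg⟩ := hg
  have hz : ∀ z, g z ≠ 0 → ‖(2 : ℂ) + (η * z : Circle)‖ * ‖(2 : ℂ) + (ζ * z : Circle)‖ =
      ‖(2 : ℂ) + (η * ζ * z : Circle)‖ * ‖(2 : ℂ) + z‖ := fun z hz => by
    have h1 := h z
    have h2 := h (ζ * z)
    dsimp only at h1 h2
    rw [mul_left_comm η ζ z, hg, hg, ← mul_assoc, mul_comm ζ η] at h2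
    have h3 : g (η * z) ≠ 0 := fun H => by
      rw [H, zero_mul] at h1
      exact mul_ne_zero hz (norm_ne_zero_iff.2 (two_add_ne_zero z)) h1.symm
    refine mul_left_cancel₀ h3 ?_
    linear_combination ‖(2 : ℂ) + (ζ * z : Circle)‖ * h1 - ‖(2 : ℂ) + z‖ * h2
  -- `g` has at most one zero on the forward orbit of `1`, so it has none from some point on.
  obtain ⟨a, ha⟩ : ∃ a : Circle, ∀ n : ℕ, g (c ^ n * a) ≠ 0 := by
    by_cases H : ∀ n : ℕ, g (c ^ n * 1) ≠ 0
    · exact ⟨1, H⟩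
    · push Not at H
      obtain ⟨k, hk⟩ := H
      refine ⟨c * (c ^ k * 1), fun n => ?_⟩
      rw [← mul_assoc, ← pow_succ]
      exact h0 _ n hk
  rcases eq_one_or_eq_one_of_norm_two_add (forall_of_forall_pow_mul hc
    (isClosed_eq (by fun_prop) (by fun_prop)) a fun n => hz _ (ha n)) with h | h
  · exact hη h
  · exact hζ h

/-! ### Functional calculus of a unitary on the circle -/

section Calculus

variable {A : Type*} [CStarAlgebra A]

theorem isStarNormal_of_mem_unitary {w : A} (hw : w ∈ unitary A) : IsStarNormal w :=
  ⟨by rw [commute_iff_eq, (Unitary.mem_iff.1 hw).1, (Unitary.mem_iff.1 hw).2]⟩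

theorem circleCalculus_eq_cfc {w : A} (hw : w ∈ unitary A) {f : Circle → ℂ} {F : ℂ → ℂ}
    (h : ∀ z : Circle, F z = f z) : circleCalculus f w = cfc F w :=
  cfc_congr fun z hz => by
    obtain ⟨ζ, rfl⟩ := exists_circle_coe_eq (spectrum.subset_circle_of_unitary hw hz)
    rw [extend_coe, h]

/-- The functional calculus of a unitary `w` as a *-homomorphism `C(S¹) → A`. -/
noncomputable def circleHom (w : A) (hw : w ∈ unitary A) : C(Circle, ℂ) →⋆ₐ[ℂ] A where
  toFun f := circleCalculus f w
  map_one' := by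
    have := isStarNormal_of_mem_unitary hw
    exact (circleCalculus_eq_cfc hw (F := 1) fun _ => rfl).trans (cfc_one ℂ w)
  map_mul' f g := by
    have hs := spectrum.subset_circle_of_unitary (𝕜 := ℂ) hw
    refine (circleCalculus_eq_cfc hw fun z => ?_).trans
      (cfc_mul (R := ℂ) (hf := continuousOn_extend f.continuous hs)
        (hg := continuousOn_extend g.continuous hs))
    simp [extend_coe]
  map_zero' := by
    exact (circleCalculus_eq_cfc hw (F := 0) fun _ => rfl).trans (cfc_zero ℂ w)
  map_add' f g := by
    have hs := spectrum.subset_circle_of_unitary (𝕜 := ℂ) hw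
    refine (circleCalculus_eq_cfc hw fun z => ?_).trans
      (cfc_add (R := ℂ) (hf := continuousOn_extend f.continuous hs)
        (hg := continuousOn_extend g.continuous hs))
    simp [extend_coe]
  commutes' r := by
    have := isStarNormal_of_mem_unitary hw
    exact (circleCalculus_eq_cfc hw (F := fun _ => r) fun _ => rfl).trans (cfc_const r w)
  map_star' f := by
    rw [circleCalculus, circleCalculus, ← cfc_star]
    exact circleCalculus_eq_cfc hw fun z => by simp [extend_coe]

theorem circleCalculus_coe {w : A} (hw : w ∈ unitary A) :
    circleCalculus (fun z => (z : ℂ)) w = w := by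
  have := isStarNormal_of_mem_unitary hw
  rw [circleCalculus_eq_cfc hw (F := fun z => z) fun _ => rfl, cfc_id' ℂ w]

theorem circleCalculus_smul (c : Circle) {w : A} (hw : w ∈ unitary A) {f : Circle → ℂ}
    (hf : Continuous f) :
    circleCalculus f ((c : ℂ) • w) = circleCalculus (fun z => f (c * z)) w := by
  have := isStarNormal_of_mem_unitary hw
  have hs : (fun z : ℂ => (c : ℂ) • z) '' spectrum ℂ w ⊆ Metric.sphere 0 1 := by
    rintro _ ⟨z, hz, rfl⟩
    obtain ⟨ζ, rfl⟩ := exists_circle_coe_eq (spectrum.subset_circle_of_unitary hw hz)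
    exact (c * ζ).2
  rw [circleCalculus, ← cfc_comp_smul (c : ℂ) _ w (continuousOn_extend hf hs)]
  refine (circleCalculus_eq_cfc hw fun z => ?_).symm
  rw [smul_eq_mul, ← Circle.coe_mul, extend_coe]

theorem star_circleCalculus_ofReal {w : A} (f : Circle → ℝ) :
    star (circleCalculus (fun z => (f z : ℂ)) w) = circleCalculus (fun z => (f z : ℂ)) w := by
  rw [circleCalculus, ← cfc_star]
  congr 1
  ext z
  by_cases h : ∃ ζ : Circle, (ζ : ℂ) = z
  · obtain ⟨ζ, rfl⟩ := h
    simp [extend_coe]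
  · simp [Function.extend_apply' _ _ _ h]

theorem cstarGen_le {S : Set A} {T : StarSubalgebra ℂ A} (hT : IsClosed (T : Set A))
    (h : S ⊆ T) : cstarGen S ≤ T :=
  StarSubalgebra.topologicalClosure_minimal (StarAlgebra.adjoin_le h) hT

theorem isClosed_cstarGen (S : Set A) : IsClosed (cstarGen S : Set A) :=
  StarSubalgebra.isClosed_topologicalClosure _

theorem subset_cstarGen (S : Set A) : S ⊆ cstarGen S :=
  (StarAlgebra.subset_adjoin ℂ S).trans (StarSubalgebra.le_topologicalClosure _)

/-- `C*(w)` contains `h(w)` for all continuous functions `h` on the circle. -/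
theorem circleCalculus_mem_of_mem {w : A} (hw : w ∈ unitary A) {T : StarSubalgebra ℂ A}
    (hT : IsClosed (T : Set A)) (hwT : w ∈ T) (h : C(Circle, ℂ)) : circleCalculus h w ∈ T := by
  let D : StarSubalgebra ℂ C(Circle, ℂ) := T.comap (circleHom w hw)
  have hD : IsClosed (D : Set C(Circle, ℂ)) := hT.preimage (continuous_starAlgHom (circleHom w hw))
  have hsep : D.SeparatesPoints := fun a b hab =>
    ⟨_, ⟨⟨fun z => (z : ℂ), continuous_subtype_val⟩,
      show circleCalculus (fun z => (z : ℂ)) w ∈ T by rwa [circleCalculus_coe hw], rfl⟩,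
      fun H => hab (Circle.ext H)⟩
  have htop := ContinuousMap.starSubalgebra_topologicalClosure_eq_top_of_separatesPoints D hsep
  have : h ∈ D.topologicalClosure := htop ▸ StarSubalgebra.mem_top
  exact StarSubalgebra.topologicalClosure_minimal le_rfl hD this

end Calculus

/-! ### Pairs of unitaries with a rotation relation -/

section RotationPair

variable {B : Type*} [CStarAlgebra B] {c : Circle} {u v : B}

theorem circleCalculus_smul_eq_conj (hu : u ∈ unitary B) (hv : v ∈ unitary B)
    (h : v * u = (c : ℂ) • (u * v)) {f : Circle → ℂ} (hf : Continuous f) :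
    star u * circleCalculus f v * u = circleCalculus (fun z => f (c * z)) v := by
  have h1 : star u * v * u = (c : ℂ) • v := by
    rw [mul_assoc, h, mul_smul_comm, ← mul_assoc, (Unitary.mem_iff.1 hu).1, one_mul]
  have h2 := map_circleCalculus
    (Unitary.conjStarAlgAut ℂ B (star (⟨u, hu⟩ : unitary B)) : B →⋆ₐ[ℂ] B) hf hv
  simp only [StarAlgHom.coe_coe, Unitary.conjStarAlgAut_star_apply] at h2
  rw [h2, h1, circleCalculus_smul c hv hf]

theorem circleCalculus_mul_unitary (hu : u ∈ unitary B) (hv : v ∈ unitary B)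
    (h : v * u = (c : ℂ) • (u * v)) {f : Circle → ℂ} (hf : Continuous f) :
    circleCalculus f v * u = u * circleCalculus (fun z => f (c * z)) v := by
  rw [← circleCalculus_smul_eq_conj hu hv h hf, ← mul_assoc, ← mul_assoc,
    (Unitary.mem_iff.1 hu).2, one_mul]

theorem unitary_mul_circleCalculus_mul_star (hu : u ∈ unitary B) (hv : v ∈ unitary B)
    (h : v * u = (c : ℂ) • (u * v)) {f : Circle → ℂ} (hf : Continuous f) :
    u * circleCalculus f v * star u = circleCalculus (fun z => f (c⁻¹ * z)) v := by
  have h1 := circleCalculus_mul_unitary hu hv h (f := fun z => f (c⁻¹ * z)) (by fun_prop)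
  simp only [inv_mul_cancel_left] at h1
  rw [← h1, mul_assoc, (Unitary.mem_iff.1 hu).2, mul_one]

/-- Let `g ≥ 0` be a non-periodic function with at most one zero on each orbit. The functions `h`
with `h(v)` in `C*(u g^{1/2}(v))` form a closed *-algebra that is invariant under
`P ↦ g · P(c ·)` and `P ↦ (g · P)(c⁻¹ ·)`. Applied repeatedly to the constant function `1`, these
operations give functions that separate points. -/
theorem circleCalculus_mem_cstarGen (hc : DenseRange (fun n : ℕ => c ^ n)) (hu : u ∈ unitary B)
    (hv : v ∈ unitary B) (h : v * u = (c : ℂ) • (u * v)) (g : C(Circle, ℝ)) (hg : ∀ z, 0 ≤ g z)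
    (hper : ¬ IsCirclePeriodic g)
    (h0 : ∀ (z : Circle) (m : ℕ), g z = 0 → g (c ^ (m + 1) * z) ≠ 0) (k : C(Circle, ℂ)) :
    circleCalculus k v ∈ cstarGen {u * circleCalculus (fun z => (√(g z) : ℝ)) v} := by
  set f : C(Circle, ℂ) := ⟨fun z => (√(g z) : ℝ), by fun_prop⟩ with hf
  set T := cstarGen {u * circleCalculus (fun z => (√(g z) : ℝ)) v}
  have hy : u * circleHom v hv f ∈ T := subset_cstarGen _ rfl
  have hfs : star (circleHom v hv f) = circleHom v hv f := star_circleCalculus_ofReal _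
  have hy' : circleHom v hv f * star u ∈ T := by
    have := star_mem hy
    rwa [star_mul, hfs] at this
  have hff : ∀ z, f z * f z = (g z : ℂ) := fun z => by
    simp only [hf, ContinuousMap.coe_mk]
    rw [← Complex.ofReal_mul, Real.mul_self_sqrt (hg z)]
  let D : StarSubalgebra ℂ C(Circle, ℂ) := T.comap (circleHom v hv)
  have hmem : ∀ P : C(Circle, ℂ), P ∈ D ↔ circleHom v hv P ∈ T := fun P => Iff.rfl
  have hD : IsClosed (D : Set C(Circle, ℂ)) :=
    (isClosed_cstarGen _).preimage (continuous_starAlgHom (circleHom v hv))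
  have hconj : ∀ P : C(Circle, ℂ), star u * circleHom v hv P * u =
      circleHom v hv (P.comp (.mulLeft c)) := fun P =>
    circleCalculus_smul_eq_conj hu hv h P.continuous
  have hconj' : ∀ P : C(Circle, ℂ), u * circleHom v hv P * star u =
      circleHom v hv (P.comp (.mulLeft c⁻¹)) := fun P =>
    unitary_mul_circleCalculus_mul_star hu hv h P.continuous
  have hfwd : ∀ n : ℕ, (⟨fun z => ((∏ k ∈ Finset.range n, g (c ^ k * z) : ℝ) : ℂ),
      by fun_prop⟩ : C(Circle, ℂ)) ∈ D := fun n => by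
    induction n with
    | zero => exact one_mem D
    | succ n ih =>
      rw [hmem] at ih ⊢
      have h1 := mul_mem (mul_mem hy' ih) hy
      rw [show ∀ a b d : B, a * star u * b * (u * d) = a * (star u * b * u) * d by
        intros; simp only [mul_assoc], hconj, ← map_mul, ← map_mul] at h1
      convert h1 using 2
      ext z
      simp only [ContinuousMap.mul_apply, ContinuousMap.comp_apply, ContinuousMap.coe_mulLeft,
        ContinuousMap.coe_mk]
      rw [mul_right_comm, hff, Finset.prod_range_succ', mul_comm]
      simp [pow_succ, mul_assoc]
  have hbwd : ∀ n : ℕ, (⟨fun z => ((∏ k ∈ Finset.range n, g (c⁻¹ ^ (k + 1) * z) : ℝ) : ℂ),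
      by fun_prop⟩ : C(Circle, ℂ)) ∈ D := fun n => by
    induction n with
    | zero => exact one_mem D
    | succ n ih =>
      rw [hmem] at ih ⊢
      have h1 := mul_mem (mul_mem hy ih) hy'
      rw [show ∀ a b d : B, u * a * b * (d * star u) = u * (a * b * d) * star u by
        intros; simp only [mul_assoc], ← map_mul, ← map_mul, hconj'] at h1
      convert h1 using 2
      ext z
      simp only [ContinuousMap.mul_apply, ContinuousMap.comp_apply, ContinuousMap.coe_mulLeft,
        ContinuousMap.coe_mk]
      rw [mul_right_comm, hff, Finset.prod_range_succ', mul_comm]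
      simp [pow_succ, mul_assoc]
  have hsep : D.SeparatesPoints := fun a b hab => by
    obtain ⟨n, hn | hn⟩ := exists_prod_ne hc g hper h0 hab
    · exact ⟨_, ⟨_, hfwd n, rfl⟩, fun H => hn (Complex.ofReal_injective H)⟩
    · exact ⟨_, ⟨_, hbwd n, rfl⟩, fun H => hn (Complex.ofReal_injective H)⟩
  have htop := ContinuousMap.starSubalgebra_topologicalClosure_eq_top_of_separatesPoints D hsep
  have : k ∈ D.topologicalClosure := htop ▸ StarSubalgebra.mem_top
  exact StarSubalgebra.topologicalClosure_minimal le_rfl hD this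

/-- The spectrum of `v` is invariant under the rotation by `c`, so it is infinite. -/
theorem aeval_ne_zero [Nontrivial B] (hc : DenseRange (fun n : ℕ => c ^ n)) (hu : u ∈ unitary B)
    (hv : v ∈ unitary B) (h : v * u = (c : ℂ) • (u * v)) {p : Polynomial ℂ} (hp : p ≠ 0) :
    Polynomial.aeval v p ≠ 0 := by
  intro H
  have h1 : star u * v * u = (c : ℂ) • v := by
    rw [mul_assoc, h, mul_smul_comm, ← mul_assoc, (Unitary.mem_iff.1 hu).1, one_mul]
  have hinv : ∀ z ∈ spectrum ℂ v, (c : ℂ) * z ∈ spectrum ℂ v := fun z hz => by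
    have h2 := AlgEquiv.spectrum_eq
      (Unitary.conjStarAlgAut ℂ B (star (⟨u, hu⟩ : unitary B))) v
    rw [Unitary.conjStarAlgAut_star_apply, h1] at h2
    rw [← h2]
    have h3 := spectrum.smul_mem_smul_iff (R := ℂ) (a := v) (s := z)
      (r := Units.mk0 (c : ℂ) (Circle.coe_ne_zero c))
    exact h3.2 hz
  obtain ⟨z, hz⟩ := spectrum.nonempty v
  have hpow : ∀ n : ℕ, (c : ℂ) ^ n * z ∈ spectrum ℂ v := fun n => by
    induction n with
    | zero => simpa using hz
    | succ n ih => rw [pow_succ', mul_assoc]; exact hinv _ ih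
  have hroot : ∀ y ∈ spectrum ℂ v, p.IsRoot y := fun y hy => by
    have := spectrum.subset_polynomial_aeval v p ⟨y, hy, rfl⟩
    rw [H, spectrum.zero_eq] at this
    exact this
  obtain ⟨ζ, rfl⟩ := exists_circle_coe_eq (spectrum.subset_circle_of_unitary hv hz)
  have hfin : (Set.range fun n : ℕ => c ^ n).Finite := by
    have hf := (p.roots.toFinset.finite_toSet).preimage
      (f := fun y : Circle => (y * ζ : ℂ)) (fun a _ b _ hab =>
        Circle.ext (mul_right_cancel₀ (Circle.coe_ne_zero ζ) hab))
    refine hf.subset ?_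
    rintro _ ⟨n, rfl⟩
    simpa [hp] using hroot _ (hpow n)
  have huniv : (Set.univ : Set Circle) = Set.range fun n : ℕ => c ^ n := by
    rw [← hc.closure_range, hfin.isClosed.closure_eq]
  have : Infinite (Set.Ioc (-Real.pi) Real.pi) :=
    (Set.Ioc_infinite (by linarith [Real.pi_pos])).to_subtype
  have : Infinite Circle := Infinite.of_injective _ Circle.argEquiv.symm.injective
  exact Set.infinite_univ (huniv ▸ hfin)

end RotationPair

/-! ### Finite-dimensional representations -/

theorem star_coe_mul_self (z : Circle) : star (z : ℂ) * z = 1 := by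
  rw [Complex.star_def, Complex.conj_mul', Circle.norm_coe]
  simp

theorem exp_neg_eq_coe_inv (θ : ℝ) : Complex.exp (-(2 * Real.pi * Complex.I * θ)) =
    ((Circle.exp (2 * Real.pi * θ))⁻¹ : Circle) := by
  rw [← Circle.exp_neg, Circle.coe_exp]
  push_cast
  ring_nf

open scoped Matrix.Norms.L2Operator in
theorem circleCalculus_diagonal {n : Type*} [Fintype n] [DecidableEq n] (d : n → Circle)
    {f : Circle → ℂ} (hf : Continuous f) :
    circleCalculus f (Matrix.diagonal fun k => (d k : ℂ)) = Matrix.diagonal fun k => f (d k) := by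
  let δ : (n → ℂ) →⋆ₐ[ℂ] Matrix n n ℂ :=
    { Matrix.diagonalAlgHom ℂ with map_star' := fun x => (Matrix.diagonal_conjTranspose x).symm }
  have hδ : ∀ x, δ x = Matrix.diagonal x := fun _ => rfl
  have hd : (fun k => (d k : ℂ)) ∈ unitary (n → ℂ) := by
    have h : star (fun k => (d k : ℂ)) * (fun k => (d k : ℂ)) = 1 :=
      funext fun k => star_coe_mul_self (d k)
    exact Unitary.mem_iff.2 ⟨h, by rw [mul_comm, h]⟩
  have h1 := map_circleCalculus δ hf hd
  rw [hδ, hδ] at h1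
  rw [← h1]
  congr 1
  ext k
  have h2 := map_circleCalculus (Pi.evalStarAlgHom ℂ (fun _ : n => ℂ) k) hf hd
  refine h2.trans ?_
  change cfc _ (algebraMap ℂ ℂ (d k)) = _
  rw [cfc_algebraMap, extend_coe]
  rfl

open scoped Matrix.Norms.L2Operator in
/-- If `γ` vanishes at two points `z` and `cᵐ⁺¹z` of one orbit, `c = e^{2πiθ}`, the relations are
satisfied by `(m + 1) × (m + 1)`-matrices: `w` is the diagonal matrix with entries
`cz, …, cᵐ⁺¹z`, and `x` is the weighted cyclic shift with weights `γ^{1/2}`. The zero at `cᵐ⁺¹z`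
cuts the cycle open, so the failure of `xw = c⁻¹wx` at its end does not matter. -/
theorem exists_rep_aeval_eq_zero (θ : ℝ) (γ : C(Circle, ℝ)) (hγ : ∀ z, 0 ≤ γ z) (z : Circle)
    (m : ℕ) (h0 : γ z = 0)
    (h1 : γ (Circle.exp (2 * Real.pi * θ) ^ (m + 1) * z) = 0) :
    ∃ (i : Rep.{u} θ γ) (p : Polynomial ℂ), p ≠ 0 ∧ Polynomial.aeval i.w p = 0 := by
  set c := Circle.exp (2 * Real.pi * θ)
  have hphase : Complex.exp (-(2 * Real.pi * Complex.I * θ)) = (c⁻¹ : Circle) :=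
    exp_neg_eq_coe_inv θ
  let n := ULift.{u} (Fin (m + 1))
  let d : n → Circle := fun k => c ^ (k.down.val + 1) * z
  let σ : n ≃ n := Equiv.ulift.trans ((finRotate (m + 1)).trans Equiv.ulift.symm)
  -- Along the cycle `d` is multiplied by `c`, except at the end, where the weight vanishes.
  have hσ : ∀ j, d (σ j) = c * d j ∨ (d (σ j) = c * z ∧ γ (d j) = 0) := fun j => by
    change c ^ ((finRotate (m + 1) j.down).val + 1) * z = c * (c ^ (j.down.val + 1) * z) ∨
      (c ^ ((finRotate (m + 1) j.down).val + 1) * z = c * z ∧ γ (c ^ (j.down.val + 1) * z) = 0)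
    by_cases hj : j.down = Fin.last m
    · right
      rw [hj, finRotate_last, Fin.val_zero, zero_add, pow_one, Fin.val_last]
      exact ⟨rfl, h1⟩
    · left
      rw [coe_finRotate_of_ne_last hj, pow_succ' c (_ + 1), mul_assoc]
  have hγσ : ∀ j, γ (c⁻¹ * d (σ j)) = γ (d j) := fun j => by
    rcases hσ j with h | ⟨h, h'⟩
    · rw [h, inv_mul_cancel_left]
    · rw [h, h', inv_mul_cancel_left, h0]
  let s : n → ℂ := fun j => (√(γ (d j)) : ℝ)
  have hss : ∀ j, s j * s j = γ (d j) := fun j => by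
    rw [← Complex.ofReal_mul, Real.mul_self_sqrt (hγ _)]
  let w : Matrix n n ℂ := Matrix.diagonal fun k => (d k : ℂ)
  let x : Matrix n n ℂ := Matrix.of fun i j => if i = σ j then s j else 0
  have hw : star w * w = 1 := by
    rw [Matrix.star_eq_conjTranspose, Matrix.diagonal_conjTranspose, Matrix.diagonal_mul_diagonal,
      ← Matrix.diagonal_one]
    exact congrArg _ (funext fun k => star_coe_mul_self (d k))
  have hγc : Continuous fun z => (γ z : ℂ) := by fun_prop
  refine ⟨⟨Matrix n n ℂ, x, w, ⟨hw, mul_eq_one_comm.1 hw, ?_, ?_, ?_⟩⟩,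
    ∏ k, (Polynomial.X - Polynomial.C (d k : ℂ)),
    Finset.prod_ne_zero_iff.2 fun k _ => Polynomial.X_sub_C_ne_zero _, ?_⟩
  · rw [circleCalculus_diagonal d hγc]
    ext i j
    simp only [x, Matrix.star_eq_conjTranspose, Matrix.mul_apply, Matrix.conjTranspose_apply,
      Matrix.of_apply, Matrix.diagonal_apply]
    by_cases hij : i = j
    · subst hij
      simp [← hss, s]
    · simp [hij, Ne.symm hij]
  · rw [hphase]
    have hcw : ((c⁻¹ : Circle) : ℂ) • w = Matrix.diagonal fun k => ((c⁻¹ * d k : Circle) : ℂ) := by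
      rw [← Matrix.diagonal_smul]
      rfl
    rw [hcw, circleCalculus_diagonal _ hγc]
    ext i j
    simp only [x, Matrix.star_eq_conjTranspose, Matrix.mul_apply, Matrix.conjTranspose_apply,
      Matrix.of_apply, Matrix.diagonal_apply]
    obtain ⟨i, rfl⟩ := σ.surjective i
    obtain ⟨j, rfl⟩ := σ.surjective j
    by_cases hij : i = j
    · subst hij
      simp [hγσ, ← hss, s]
    · simp [hij, Ne.symm hij]
  · rw [hphase]
    ext i j
    simp only [x, w, Matrix.mul_diagonal, Matrix.diagonal_mul, Matrix.smul_apply, Matrix.of_apply,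
      smul_eq_mul]
    split_ifs with hij
    · subst hij
      rcases hσ j with h | ⟨-, h⟩
      · rw [h, ← mul_assoc, ← Circle.coe_mul, inv_mul_cancel_left, mul_comm]
      · simp [s, h]
    · simp
  · let δ := Matrix.diagonalAlgHom (n := n) (α := ℂ) ℂ
    change Polynomial.aeval (δ fun k => (d k : ℂ)) _ = 0
    rw [Polynomial.aeval_algHom_apply, ← map_zero δ]
    congr 1
    ext k
    change Pi.evalAlgHom ℂ (fun _ : n => ℂ) k (Polynomial.aeval _ _) = 0
    rw [← Polynomial.aeval_algHom_apply, map_prod]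
    refine Finset.prod_eq_zero (Finset.mem_univ k) ?_
    rw [map_sub, Polynomial.aeval_X, Polynomial.aeval_C]
    exact sub_self _

/-! ### The algebra `A_{θ,γ}` -/

theorem injective_of_isSimpleCStarAlgebra {A B : Type*} [CStarAlgebra A] [CStarAlgebra B]
    [Nontrivial B] (hA : IsSimpleCStarAlgebra A) (Φ : A →⋆ₐ[ℂ] B) : Function.Injective Φ := by
  have hmem : ∀ a, a ∈ TwoSidedIdeal.ker Φ ↔ Φ a = 0 := fun a => TwoSidedIdeal.mem_ker _
  have hcl : IsClosed (TwoSidedIdeal.ker Φ : Set A) := by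
    have : (TwoSidedIdeal.ker Φ : Set A) = Φ ⁻¹' {0} := Set.ext hmem
    rw [this]
    exact isClosed_singleton.preimage (continuous_starAlgHom Φ)
  rcases hA.2 _ hcl with h | h
  · exact (TwoSidedIdeal.ker_eq_bot Φ).1 h
  · have : (1 : A) ∈ TwoSidedIdeal.ker Φ := h ▸ trivial
    rw [hmem, map_one] at this
    exact absurd this one_ne_zero

theorem Relations.of_map {A B : Type*} [CStarAlgebra A] [CStarAlgebra B] {θ : ℝ}
    {γ : C(Circle, ℝ)} (ι : A →⋆ₐ[ℂ] B) (hι : Function.Injective ι) {x w : A}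
    (h : Relations θ γ (ι x) (ι w)) : Relations θ γ x w := by
  have h1 : star w * w = 1 := hι (by rw [map_mul, map_star, map_one, h.star_mul_w])
  have h2 : w * star w = 1 := hι (by rw [map_mul, map_star, map_one, h.w_mul_star])
  have hw : w ∈ unitary A := Unitary.mem_iff.2 ⟨h1, h2⟩
  have hγ : Continuous fun z : Circle => (γ z : ℂ) := by fun_prop
  refine ⟨h1, h2, hι ?_, hι ?_, hι ?_⟩
  · rw [map_mul, map_star, map_circleCalculus _ hγ hw, h.star_mul_x]
  · rw [map_mul, map_star, map_circleCalculus _ hγ (smul_mem_unitary (norm_phase θ) hw),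
      map_smul, h.x_mul_star]
  · rw [map_mul, map_smul, map_mul, h.x_mul_w]

theorem range_eq_cstarGen {θ : ℝ} {γ : C(Circle, ℝ)} {B : Type u} [CStarAlgebra B] [Nontrivial B]
    (Φ : GenRotAlgebra.{u} θ γ →⋆ₐ[ℂ] B) (hΦ : Function.Injective Φ)
    (h : Relations θ γ (Φ (genX θ γ)) (Φ (genW θ γ))) :
    Φ.range = cstarGen {Φ (genX θ γ), Φ (genW θ γ)} := by
  set T := cstarGen {Φ (genX θ γ), Φ (genW θ γ)}
  refine le_antisymm ?_ (cstarGen_le ?_ ?_)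
  · let _ : CStarAlgebra T := StarSubalgebra.cstarAlgebra T (h_closed := isClosed_cstarGen _)
    -- By the universal property, `Φ` factors through the subalgebra `T`.
    obtain ⟨Ψ, ⟨hx, hw⟩, -⟩ := GenRotAlgebra.existsUnique_hom θ γ (B := T)
      (Relations.of_map T.subtype Subtype.val_injective
        (x := ⟨_, subset_cstarGen _ (Set.mem_insert _ _)⟩)
        (w := ⟨_, subset_cstarGen _ (Set.mem_insert_of_mem _ rfl)⟩) h)
    have huniq : Φ = T.subtype.comp Ψ := (GenRotAlgebra.existsUnique_hom θ γ h).unique ⟨rfl, rfl⟩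
      ⟨congrArg Subtype.val hx, congrArg Subtype.val hw⟩
    rintro _ ⟨a, rfl⟩
    rw [huniq]
    exact (Ψ a).2
  · have := (NonUnitalStarAlgHom.isometry Φ hΦ).isClosedEmbedding.isClosed_range
    exact this
  · rintro _ (rfl | rfl)
    · exact ⟨_, rfl⟩
    · exact ⟨_, rfl⟩

/-- Two unitaries with the rotation relation give a representation of the relations. -/
theorem relations_of_unitary {B : Type*} [CStarAlgebra B] {θ : ℝ} {γ : C(Circle, ℝ)}
    (hγ : ∀ z, 0 ≤ γ z) {u v : B} (hu : u ∈ unitary B) (hv : v ∈ unitary B)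
    (h : v * u = (Circle.exp (2 * Real.pi * θ) : ℂ) • (u * v)) :
    Relations θ γ (u * circleCalculus (fun z => (√(γ z) : ℝ)) v) v := by
  set c := Circle.exp (2 * Real.pi * θ)
  have hphase : Complex.exp (-(2 * Real.pi * Complex.I * θ)) = (c⁻¹ : Circle) :=
    exp_neg_eq_coe_inv θ
  let f : C(Circle, ℂ) := ⟨fun z => (√(γ z) : ℝ), by fun_prop⟩
  let g : C(Circle, ℂ) := ⟨fun z => γ z, by fun_prop⟩
  let e : C(Circle, ℂ) := ⟨fun z => z, continuous_subtype_val⟩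
  have hff : circleHom v hv f * circleHom v hv f = circleHom v hv g := by
    rw [← map_mul]
    congr 1
    ext z
    change ((√(γ z) : ℝ) : ℂ) * (√(γ z) : ℝ) = γ z
    rw [← Complex.ofReal_mul, Real.mul_self_sqrt (hγ z)]
  have hfs : star (circleHom v hv f) = circleHom v hv f := star_circleCalculus_ofReal _
  have hcomm : circleHom v hv f * v = v * circleHom v hv f := by
    have he : circleHom v hv e = v := circleCalculus_coe hv
    calc _ = circleHom v hv f * circleHom v hv e := by rw [he]
      _ = circleHom v hv e * circleHom v hv f := by rw [← map_mul, mul_comm, map_mul]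
      _ = _ := by rw [he]
  have huv : u * v = ((c⁻¹ : Circle) : ℂ) • (v * u) := by
    rw [h, smul_smul, ← Circle.coe_mul, inv_mul_cancel, Circle.coe_one, one_smul]
  obtain ⟨hv1, hv2⟩ := Unitary.mem_iff.1 hv
  change Relations θ γ (u * circleHom v hv f) v
  refine ⟨hv1, hv2, ?_, ?_, ?_⟩
  · rw [star_mul, hfs, mul_assoc, ← mul_assoc (star u), (Unitary.mem_iff.1 hu).1, one_mul, hff]
    rfl
  · rw [hphase, star_mul, hfs, ← mul_assoc, mul_assoc u, hff]
    refine Eq.trans ?_ (circleCalculus_smul c⁻¹ hv g.continuous).symm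
    exact unitary_mul_circleCalculus_mul_star hu hv h g.continuous
  · rw [hphase, mul_assoc, hcomm, ← mul_assoc, huv, smul_mul_assoc, mul_assoc]

/-- If `A_{θ,γ}` is simple, then `γ` has at most one zero on each orbit. -/
theorem ne_zero_of_isSimpleCStarAlgebra {θ : ℝ} (hθ : Irrational θ) {γ : C(Circle, ℝ)}
    (hγ : ∀ z, 0 ≤ γ z) (hsimple : IsSimpleCStarAlgebra (GenRotAlgebra.{u} θ γ))
    {B : Type u} [CStarAlgebra B] [Nontrivial B] {u v : B} (hu : u ∈ unitary B)
    (hv : v ∈ unitary B) (h : v * u = (Circle.exp (2 * Real.pi * θ) : ℂ) • (u * v))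
    (z : Circle) (m : ℕ) (h0 : γ z = 0) :
    γ (Circle.exp (2 * Real.pi * θ) ^ (m + 1) * z) ≠ 0 := by
  intro h1
  obtain ⟨i, p, hp, hpw⟩ := exists_rep_aeval_eq_zero.{u} θ γ hγ z m h0 h1
  obtain ⟨Ψ, ⟨-, hΨ⟩, -⟩ := GenRotAlgebra.existsUnique_hom θ γ i.rel
  obtain ⟨Φ, ⟨-, hΦ⟩, -⟩ := GenRotAlgebra.existsUnique_hom θ γ (relations_of_unitary hγ hu hv h)
  have hzero : Polynomial.aeval (genW θ γ) p = 0 :=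
    injective_of_isSimpleCStarAlgebra hsimple Ψ (by
      rw [map_zero, ← hpw, ← hΨ]
      exact (Polynomial.aeval_algHom_apply Ψ.toAlgHom _ p).symm)
  refine aeval_ne_zero (denseRange_exp_pow hθ) hu hv h hp ?_
  rw [← hΦ, ← map_zero Φ, ← hzero]
  exact Polynomial.aeval_algHom_apply Φ.toAlgHom _ p

end RotationAlgebra

theorem mainTheorem12 (θ : ℝ) (hθ : Irrational θ) (γ : C(Circle, ℝ)) (hγ : ∀ z, 0 ≤ γ z)
    (hsimple : IsSimpleCStarAlgebra (GenRotAlgebra.{u} θ γ)) :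
    ∃ f : C(Circle, ℂ),
      (¬ IsCirclePeriodic γ → ∀ z, f z = (√(γ z) : ℝ)) ∧
      (IsCirclePeriodic γ →
        (∀ z, f z = (√(γ z * ‖2 + (z : ℂ)‖) : ℝ)) ∨
        (∀ z, f z = (√(γ z * ‖3 + (z : ℂ)‖) : ℝ))) ∧
      ∀ (B : Type u) [CStarAlgebra B] [Nontrivial B] (u v : B),
        u ∈ unitary B → v ∈ unitary B →
        v * u = Complex.exp (2 * Real.pi * Complex.I * θ) • (u * v) →
        ∃ Φ : GenRotAlgebra.{u} θ γ →⋆ₐ[ℂ] B,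
          Function.Injective Φ ∧
          Φ (genX θ γ) = u * circleCalculus (fun z => (√(γ z) : ℝ)) v ∧
          Φ (genW θ γ) = v ∧
          Φ.range = cstarGen {u * circleCalculus (fun z => (√(γ z) : ℝ)) v, v} ∧
          Φ.range = cstarGen {u * circleCalculus f v} := by
  set c := Circle.exp (2 * Real.pi * θ) with hc
  have hphase : Complex.exp (2 * Real.pi * Complex.I * θ) = c := by
    rw [hc, Circle.coe_exp]
    push_cast
    ring_nf
  have hdense := denseRange_exp_pow hθ
  -- The weight `k` is `1` or `‖2 + z‖`, and `f = (γ k)^{1/2}`.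
  obtain ⟨k, hk, hk1, hk2, hk3⟩ : ∃ k : C(Circle, ℝ), (∀ z, 0 < k z) ∧
      (¬ IsCirclePeriodic γ → ∀ z, k z = 1) ∧ (IsCirclePeriodic γ → ∀ z, k z = ‖2 + (z : ℂ)‖) ∧
      ((∀ (z : Circle) (m : ℕ), γ z = 0 → γ (c ^ (m + 1) * z) ≠ 0) →
        ¬ IsCirclePeriodic (γ * k : C(Circle, ℝ))) := by
    by_cases hper : IsCirclePeriodic γ
    · exact ⟨⟨fun z => ‖2 + (z : ℂ)‖, by fun_prop⟩,
        fun z => norm_pos_iff.2 (two_add_ne_zero z), fun h => absurd hper h, fun _ _ => rfl,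
        not_isCirclePeriodic_mul_norm hdense γ hper⟩
    · exact ⟨1, fun _ => one_pos, fun _ _ => rfl, fun h => absurd h hper,
        fun _ => by rwa [mul_one]⟩
  refine ⟨⟨fun z => (√(γ z * k z) : ℝ), by fun_prop⟩, fun h z => ?_, fun h => Or.inl fun z => ?_,
    fun B _ _ u v hu hv huv => ?_⟩
  · simp [hk1 h]
  · simp [hk2 h]
  rw [hphase] at huv
  have hrel := relations_of_unitary hγ hu hv huv
  obtain ⟨Φ, ⟨hx, hw⟩, -⟩ := GenRotAlgebra.existsUnique_hom θ γ hrel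
  have hinj := injective_of_isSimpleCStarAlgebra hsimple Φ
  have hrange : Φ.range = cstarGen {u * circleCalculus (fun z => (√(γ z) : ℝ)) v, v} := by
    have := range_eq_cstarGen Φ hinj (by rwa [hx, hw])
    rwa [hx, hw] at this
  refine ⟨Φ, hinj, hx, hw, hrange, hrange.trans ?_⟩
  have h0 : ∀ (z : Circle) (m : ℕ), γ z = 0 → γ (c ^ (m + 1) * z) ≠ 0 :=
    ne_zero_of_isSimpleCStarAlgebra hθ hγ hsimple hu hv huv
  let a : C(Circle, ℂ) := ⟨fun z => (√(γ z) : ℝ), by fun_prop⟩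
  let b : C(Circle, ℂ) := ⟨fun z => (√(k z) : ℝ), by fun_prop⟩
  let b' : C(Circle, ℂ) := ⟨fun z => ((√(k z))⁻¹ : ℝ), Complex.continuous_ofReal.comp
    ((by fun_prop : Continuous fun z => √(k z)).inv₀ fun z => (Real.sqrt_pos.2 (hk z)).ne')⟩
  let f : C(Circle, ℂ) := ⟨fun z => (√(γ z * k z) : ℝ), by fun_prop⟩
  have hfa : f = a * b := by
    ext z
    change ((√(γ z * k z) : ℝ) : ℂ) = (√(γ z) : ℝ) * (√(k z) : ℝ)
    rw [Real.sqrt_mul (hγ z), Complex.ofReal_mul]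
  have haf : a = f * b' := by
    ext z
    change ((√(γ z) : ℝ) : ℂ) = (√(γ z * k z) : ℝ) * ((√(k z))⁻¹ : ℝ)
    rw [Real.sqrt_mul (hγ z), ← Complex.ofReal_mul,
      mul_inv_cancel_right₀ (Real.sqrt_pos.2 (hk z)).ne']
  have hmem : ∀ h : C(Circle, ℂ), circleHom v hv h ∈ cstarGen {u * circleHom v hv f} :=
    circleCalculus_mem_cstarGen hdense hu hv huv (γ * k) (fun z => mul_nonneg (hγ z) (hk z).le)
      (hk3 h0) fun z m hz hz' => h0 z m ((mul_eq_zero_iff_right (hk _).ne').1 hz)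
        ((mul_eq_zero_iff_right (hk _).ne').1 hz')
  change cstarGen {u * circleHom v hv a, v} = cstarGen {u * circleHom v hv f}
  refine le_antisymm (cstarGen_le (isClosed_cstarGen _) ?_) (cstarGen_le (isClosed_cstarGen _) ?_)
  · have hx : u * circleHom v hv a ∈ cstarGen {u * circleHom v hv f} := by
      rw [haf, map_mul, ← mul_assoc]
      exact mul_mem (subset_cstarGen _ rfl) (hmem b')
    have hw : v ∈ cstarGen {u * circleHom v hv f} := by
      have h := hmem ⟨fun z => z, continuous_subtype_val⟩
      have hid : circleHom v hv ⟨fun z => z, continuous_subtype_val⟩ = v := circleCalculus_coe hv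
      rwa [hid] at h
    exact Set.insert_subset hx (Set.singleton_subset_iff.2 hw)
  · have hx : u * circleHom v hv a ∈ cstarGen {u * circleHom v hv a, v} :=
      subset_cstarGen _ (Set.mem_insert _ _)
    have hw : v ∈ cstarGen {u * circleHom v hv a, v} :=
      subset_cstarGen _ (Set.mem_insert_of_mem _ (Set.mem_singleton v))
    have hb : circleHom v hv b ∈ cstarGen {u * circleHom v hv a, v} :=
      circleCalculus_mem_of_mem hv (isClosed_cstarGen _) hw b
    have hy : u * circleHom v hv f ∈ cstarGen {u * circleHom v hv a, v} := by
      rw [hfa, map_mul, ← mul_assoc]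
      exact mul_mem hx hb
    exact Set.singleton_subset_iff.2 hy
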